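/- A two-row Young diagram of shape $\lambda=(a,b)$ has a top row of $a$ boxes and a left-justified bottom row of $b$ boxes. A row-standard filling of content $\mu=(\mu_1,\dots,\mu_M)$ assigns the integers $1,\dots,M$ to the boxes, the value $i$ being used exactly $\mu_i$ times, such that entries strictly increase from left to right along each row. Given two boxes in the same column of such a filling, with entries $i<j$, let $i_k$ and $j_k$ denote the entries $k$ boxes to the right of $i$ and of $j$ respectively (if they exist). The two boxes form an inversion pair if there is $n\ge 0$ such that $i_k,j_k$ exist and $i_k=j_k$ for all $1\le k\le n$, and either (1) at least one of $i_{n+1},j_{n+1}$ does not exist and $i$ lies below $j$; or (2) both $i_{n+1}$ and $j_{n+1}$ exist and $i_{n+1}>j_{n+1}$. Inversion pairs are counted by pairs of boxes, that is, with multiplicity. Let $S_k(\lambda,\mu)$ be the set of row-standard fillings of shape $\lambda$ and content $\mu$ that have exactly $k$ inversion pairs. **Theorem.** Let $\lambda=(a,b)$ with $a\ge b\ge 1$, and let $\mu=(\mu_1,\dots,\mu_M)$ be a content with $\sum_i\mu_i=a+b$ such that $\mu_i=2$ for exactly $m$ indices $i$ and $\mu_i=1$ for the remaining $a+b-2m$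 indices. Then, for every integer $k\ge 0$, $$|S_k(\lambda,\mu)| \;=\; \frac{a-b+1+2k}{a+1+k-m}\binom{a+b-2m}{b-k-m},$$ where the binomial coefficient is $0$ if $b-k-m<0$. -/

import Mathlib

/-- A filling of a Young diagram: positive integers (possibly repeated) in the cells, such that
no integer is skipped. Cells are `(row, column)`, numbered from `0`, rows going downwards.
As for Mathlib's `SemistandardYoungTableau`, the entry is `0` outside the diagram. -/
structure YoungFilling (lam : YoungDiagram) where
  entry : ℕ → ℕ → ℕ
  pos : ∀ {i j : ℕ}, (i, j) ∈ lam → 0 < entry i j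
  zeros : ∀ {i j : ℕ}, (i, j) ∉ lam → entry i j = 0
  noSkip : ∀ {i j : ℕ}, (i, j) ∈ lam → ∀ v : ℕ, 0 < v → v ≤ entry i j →
    ∃ i' j' : ℕ, (i', j') ∈ lam ∧ entry i' j' = v

namespace YoungFilling

variable {lam : YoungDiagram}

/-- Entries strictly increase from left to right along each row. -/
def RowStandard (T : YoungFilling lam) : Prop :=
  ∀ i j₁ j₂ : ℕ, j₁ < j₂ → (i, j₂) ∈ lam → T.entry i j₁ < T.entry i j₂

/-- The filling uses the values `1, …, M` only, and the value `v + 1` precisely `μ v` times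
(the index `v : Fin M` is counted from `0`). -/
def HasContent {M : ℕ} (T : YoungFilling lam) (μ : Fin M → ℕ) : Prop :=
  (∀ c ∈ lam.cells, T.entry c.1 c.2 ≤ M) ∧
    ∀ v : Fin M, (lam.cells.filter fun c => T.entry c.1 c.2 = (v : ℕ) + 1).card = μ v

/-- The entries of the cells `(p, c)` and `(q, c)` of column `c` form an inversion pair
(the smaller entry being the one in row `p`): for some `n ≥ 0`, the entries `k` boxes to the right
exist and agree for `1 ≤ k ≤ n`, and, `n + 1` boxes to the right, either one of the two entries
does not exist and row `p` is below row `q`, or both exist and the one in row `p` is larger. -/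
def IsInversionPair (T : YoungFilling lam) (c p q : ℕ) : Prop :=
  (p, c) ∈ lam ∧ (q, c) ∈ lam ∧ T.entry p c < T.entry q c ∧
    ∃ n : ℕ,
      (∀ k : ℕ, 1 ≤ k → k ≤ n →
        (p, c + k) ∈ lam ∧ (q, c + k) ∈ lam ∧ T.entry p (c + k) = T.entry q (c + k)) ∧
      ((((p, c + n + 1) ∉ lam ∨ (q, c + n + 1) ∉ lam) ∧ q < p) ∨
        ((p, c + n + 1) ∈ lam ∧ (q, c + n + 1) ∈ lam ∧
          T.entry q (c + n + 1) < T.entry p (c + n + 1)))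

open Classical in
/-- The number of inversion pairs, counted with multiplicity: a pair is determined by the two cells
`x.1` (smaller entry) and `x.2` (larger entry), which lie in the same column. -/
noncomputable def inv (T : YoungFilling lam) : ℕ :=
  ((lam.cells ×ˢ lam.cells).filter fun x =>
    x.1.2 = x.2.2 ∧ T.IsInversionPair x.1.2 x.1.1 x.2.1).card

end YoungFilling

/-- The set of `k`-inverted semistandard Young tableaux of shape `lam` and content `μ`. -/
def invertedSSYT (k : ℕ) (lam : YoungDiagram) {M : ℕ} (μ : Fin M → ℕ) : Set (YoungFilling lam) :=
  {T | T.RowStandard ∧ T.HasContent μ ∧ T.inv = k}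

/-! A row-standard filling is determined by the set `A` of values that occur only in the top row:
the repeated values `D` lie in both rows, all others only in the bottom row. With the values of `A`
as up-steps and the other single values as down-steps, it becomes a path of `a + b - 2m` steps from
height `0` to height `a - b`.

Give each column the sign of its bottom entry minus its top entry. An inversion pair sits exactly at
a column of non-zero sign whose next non-zero sign is opposite, with a virtual positive sign after
the last column (`inv_eq_signChanges`). The larger entry of an unequal column is read while the path
is on the side given by the sign of that column, so inversion pairs correspond to crossings of
height `0` (`signChanges_nth_eq_crossings`).

Paths with `k` crossings are as numerous as non-negative paths between `0` and `a - b + 2k`, because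
both counts obey the same recursion (`crossingCount_eq_ballot`). The reflection principle evaluates
the latter (`ballot_add_choose`, `ballot_mul`). -/

/-! ### Ballot numbers. -/

/-- Number of paths with `n` steps `±1` from height `y` to height `0` that never go below `0`. -/
def ballot : ℕ → ℕ → ℕ
  | 0, y => if y = 0 then 1 else 0
  | n + 1, 0 => ballot n 1
  | n + 1, y + 1 => ballot n y + ballot n (y + 2)

theorem ballot_eq_zero_of_lt {n y : ℕ} (h : n < y) : ballot n y = 0 := by
  induction n generalizing y with
  | zero => simp [ballot]; omega
  | succ n ih =>
    obtain _ | y := y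
    · omega
    · rw [ballot, ih (by omega), ih (by omega)]

theorem ballot_self (n : ℕ) : ballot n n = 1 := by
  induction n with
  | zero => rfl
  | succ n ih => rw [ballot, ih, ballot_eq_zero_of_lt (by omega)]

/-- This is the reflection principle, proved through Pascal's rule: a ballot number is a difference
of two neighbouring binomial coefficients. -/
theorem ballot_add_choose (n y j : ℕ) (h : n = y + 2 * (j + 1)) :
    ballot n y + n.choose j = n.choose (j + 1) := by
  induction n generalizing y j with
  | zero => omega
  | succ n ih =>
    obtain _ | y := y
    · rw [ballot]
      obtain _ | j := j
      · obtain rfl : n = 1 := by omega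
        rfl
      · have h1 := ih 1 j (by omega)
        -- Here `n = 2 * j + 3`, so these are the two middle coefficients; their equality encodes
        -- the reflecting boundary at height `0`.
        have h2 : n.choose (j + 1 + 1) = n.choose (j + 1) := by
          rw [← Nat.choose_symm_of_eq_add (n := n) (a := j + 1 + 1) (b := j + 1) (by omega)]
        have h3 := Nat.choose_succ_succ n j
        have h4 := Nat.choose_succ_succ n (j + 1)
        simp only [Nat.succ_eq_add_one] at h3 h4
        rw [h3, h4]
        omega
    · rw [ballot]
      have h1 := ih y j (by omega)
      obtain _ | j := j
      · obtain rfl : n = y + 2 := by omega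
        rw [ballot_self]
        simp at h1 ⊢
        omega
      · have h2 := ih (y + 2) j (by omega)
        have h3 := Nat.choose_succ_succ n j
        have h4 := Nat.choose_succ_succ n (j + 1)
        simp only [Nat.succ_eq_add_one] at h3 h4
        rw [h3, h4]
        omega

theorem ballot_mul (y j : ℕ) :
    ballot (y + 2 * j) y * (y + j + 1) = (y + 1) * (y + 2 * j).choose j := by
  obtain _ | j := j
  · simp [ballot_self]
  · have h1 := ballot_add_choose (y + 2 * (j + 1)) y j rfl
    have h2 := Nat.choose_succ_right_eq (y + 2 * (j + 1)) j
    rw [show y + 2 * (j + 1) - j = y + j + 2 by omega] at h2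
    zify at h1 h2 ⊢
    linear_combination ((y : ℤ) + j + 2) * h1 + h2

/-! ### Counting paths by their crossings of height zero. -/

/-- Read the values `V, …, 1` of a path downwards, the current height being `x`. Values in `D` do
not change the height, values in `A` are up-steps, all others are down-steps. This counts the
crossings of height `0`, where `s` tells whether the path was last seen on the positive side. -/
def crossings (A D : Finset ℕ) : ℕ → ℤ → Bool → ℕ
  | 0, _, _ => 0
  | V + 1, x, s =>
    if V + 1 ∈ D then crossings A D V x s
    else if V + 1 ∈ A then
      -- The segment between `x - 1` and `x ≤ 0` lies on the negative side, so a crossing is counted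
      -- exactly when the last recorded side was positive.
      if x ≤ 0 then (if s then 1 else 0) + crossings A D V (x - 1) false
      else crossings A D V (x - 1) s
    else
      if 0 ≤ x then (if s then 0 else 1) + crossings A D V (x + 1) true
      else crossings A D V (x + 1) s

theorem crossings_insert (A D : Finset ℕ) {V v : ℕ} (h : V < v) (x : ℤ) (s : Bool) :
    crossings (insert v A) D V x s = crossings A D V x s := by
  induction V generalizing x s with
  | zero => rfl
  | succ V ih =>
    have hv : V + 1 ≠ v := by omega
    simp only [crossings, Finset.mem_insert, hv, false_or, ih (by omega : V < v)]

/-- Number of paths of height `x` on the steps `1, …, V` that have `k` crossings. -/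
def crossingCount (D : Finset ℕ) (V : ℕ) (x : ℤ) (s : Bool) (k : ℕ) : ℕ :=
  (((Finset.Ioc 0 V) \ D).powerset.filter fun A =>
    2 * (A.card : ℤ) = (((Finset.Ioc 0 V) \ D).card : ℤ) + x ∧ crossings A D V x s = k).card

theorem Ioc_succ_sdiff_of_mem {D : Finset ℕ} {V : ℕ} (h : V + 1 ∈ D) :
    Finset.Ioc 0 (V + 1) \ D = Finset.Ioc 0 V \ D := by
  ext v
  simp only [Finset.mem_sdiff, Finset.mem_Ioc]
  constructor
  · rintro ⟨h1, h2⟩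
    have : v ≠ V + 1 := by rintro rfl; exact h2 h
    exact ⟨by omega, h2⟩
  · rintro ⟨h1, h2⟩
    exact ⟨by omega, h2⟩

theorem Ioc_succ_sdiff_of_notMem {D : Finset ℕ} {V : ℕ} (h : V + 1 ∉ D) :
    Finset.Ioc 0 (V + 1) \ D = insert (V + 1) (Finset.Ioc 0 V \ D) := by
  ext v
  simp only [Finset.mem_sdiff, Finset.mem_Ioc, Finset.mem_insert]
  constructor
  · rintro ⟨h1, h2⟩
    by_cases hv : v = V + 1
    · exact Or.inl hv
    · exact Or.inr ⟨by omega, h2⟩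
  · rintro (rfl | ⟨h1, h2⟩)
    · exact ⟨by omega, h⟩
    · exact ⟨by omega, h2⟩

theorem succ_notMem_Ioc_sdiff (D : Finset ℕ) (V : ℕ) : V + 1 ∉ Finset.Ioc 0 V \ D := by
  simp

theorem crossingCount_succ_of_mem {D : Finset ℕ} {V : ℕ} (h : V + 1 ∈ D) (x : ℤ) (s : Bool)
    (k : ℕ) : crossingCount D (V + 1) x s k = crossingCount D V x s k := by
  simp only [crossingCount, Ioc_succ_sdiff_of_mem h, crossings, h, if_true]

/-- The two summands separate the sets `A` without and with `V + 1`. At height `0` the recorded side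
`s` decides which of the two steps costs a crossing. -/
theorem crossingCount_succ_of_notMem {D : Finset ℕ} {V : ℕ} (h : V + 1 ∉ D) (x : ℤ) (s : Bool)
    (k : ℕ) : crossingCount D (V + 1) x s k =
      (if 0 ≤ x then
        if s then crossingCount D V (x + 1) true k
        else if k = 0 then 0 else crossingCount D V (x + 1) true (k - 1)
      else crossingCount D V (x + 1) s k) +
      (if x ≤ 0 then
        if s then if k = 0 then 0 else crossingCount D V (x - 1) false (k - 1)
        else crossingCount D V (x - 1) false k
      else crossingCount D V (x - 1) s k) := by
  have hS := succ_notMem_Ioc_sdiff D V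
  have hP : ∀ A ∈ (Finset.Ioc 0 V \ D).powerset, V + 1 ∉ A := fun A hA hV =>
    hS (Finset.mem_powerset.1 hA hV)
  rw [crossingCount, Ioc_succ_sdiff_of_notMem h, Finset.card_filter, Finset.sum_powerset_insert hS,
    Finset.card_insert_of_notMem hS]
  -- Both summands are instances: `y` and `r` are the height and side after the step, `e` is the
  -- number of crossings it costs, and `q A = 0` is the condition on the end point.
  have key : ∀ (y : ℤ) (r : Bool) (e l : ℕ) (f : Finset ℕ → ℕ) (q : Finset ℕ → ℤ),
      (∀ A ∈ (Finset.Ioc 0 V \ D).powerset, f A = e + crossings A D V y r ∧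
        (q A = 0 ↔ 2 * (A.card : ℤ) = ((Finset.Ioc 0 V \ D).card : ℤ) + y)) →
      (∑ A ∈ (Finset.Ioc 0 V \ D).powerset, if q A = 0 ∧ f A = l then 1 else 0) =
        if l < e then 0 else crossingCount D V y r (l - e) := by
    intro y r e l f q hfq
    split_ifs with hl
    · apply Finset.sum_eq_zero
      intro A hA
      rw [if_neg]
      rw [(hfq A hA).1]
      omega
    · rw [crossingCount, Finset.card_filter]
      apply Finset.sum_congr rfl
      intro A hA
      congr 1
      rw [(hfq A hA).1, (hfq A hA).2]
      apply propext
      apply and_congr_right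
      intro _
      omega
  have e1 : ∀ A : Finset ℕ, (2 * (A.card : ℤ) = (((Finset.Ioc 0 V \ D).card + 1 : ℕ) : ℤ) + x) ↔
      2 * (A.card : ℤ) - (((Finset.Ioc 0 V \ D).card + 1 : ℕ) : ℤ) - x = 0 := by
    intro A; constructor <;> intro h <;> linarith
  simp only [e1]
  congr 1
  · rw [key (x + 1) (if 0 ≤ x then true else s) (if 0 ≤ x then if s then 0 else 1 else 0)]
    · split_ifs <;> first | rfl | omega
    · intro A hA
      refine ⟨?_, ?_⟩
      · rw [crossings, if_neg h, if_neg (hP A hA)]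
        split_ifs <;> simp
      · push_cast
        constructor <;> intro h <;> linarith
  · rw [key (x - 1) (if x ≤ 0 then false else s) (if x ≤ 0 then if s then 1 else 0 else 0)]
    · split_ifs <;> first | rfl | omega
    · intro A hA
      refine ⟨?_, ?_⟩
      · rw [crossings, if_neg h, if_pos (Finset.mem_insert_self _ _)]
        simp only [crossings_insert _ _ (Nat.lt_succ_self V)]
        split_ifs <;> simp
      · rw [Finset.card_insert_of_notMem (hP A hA)]
        push_cast
        constructor <;> intro h <;> linarith

/-- Away from height `0` a step changes `|x| + 2k` by one in either direction. At height `0` staying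
on the recorded side gives `2k + 1`, while crossing uses up one of the `k` and gives `1 + 2(k - 1) =
2k - 1`. This is the recursion of `ballot`, including its boundary case `k = 0`. -/
theorem crossingCount_eq_ballot (D : Finset ℕ) (V : ℕ) (x : ℤ) (s : Bool) (k : ℕ)
    (hx : if s then 0 ≤ x else x ≤ 0) :
    crossingCount D V x s k = ballot (Finset.Ioc 0 V \ D).card (x.natAbs + 2 * k) := by
  induction V generalizing x s k with
  | zero =>
    have h : (2 * ((∅ : Finset ℕ).card : ℤ) = ((∅ : Finset ℕ).card : ℤ) + x ∧ 0 = k) ↔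
        x.natAbs + 2 * k = 0 := by
      simp only [Finset.card_empty]
      omega
    simp only [crossingCount, crossings, Finset.Ioc_self, Finset.empty_sdiff, Finset.powerset_empty,
      Finset.filter_singleton, h]
    rw [apply_ite Finset.card, Finset.card_singleton, Finset.card_empty,
      Finset.card_empty, ballot]
  | succ V ih =>
    by_cases h : V + 1 ∈ D
    · rw [crossingCount_succ_of_mem h, ih _ _ _ hx, Ioc_succ_sdiff_of_mem h]
    · rw [crossingCount_succ_of_notMem h, Ioc_succ_sdiff_of_notMem h,
        Finset.card_insert_of_notMem (succ_notMem_Ioc_sdiff D V)]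
      have hb : ∀ n y, ballot (n + 1) (y + 1) = ballot n y + ballot n (y + 2) := fun _ _ => rfl
      have hb0 : ∀ n, ballot (n + 1) 0 = ballot n 1 := fun _ => rfl
      rcases lt_trichotomy x 0 with h0 | rfl | h0
      · obtain rfl : s = false := by
          cases s
          · rfl
          · simp at hx; omega
        simp only [not_le.2 h0, h0.le, if_true, if_false, Bool.false_eq_true]
        rw [ih _ _ _ (by simp; omega),
          ih _ _ _ (by simp; omega),
          show x.natAbs + 2 * k = ((x + 1).natAbs + 2 * k) + 1 by omega, hb]
        congr 2
        omega
      · have h1 : ∀ l, crossingCount D V (0 + 1) true l =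
            ballot (Finset.Ioc 0 V \ D).card (2 * l + 1) := fun l => by
          rw [ih _ _ _ (by simp)]
          congr 1
          simp [add_comm]
        have h2 : ∀ l, crossingCount D V (0 - 1) false l =
            ballot (Finset.Ioc 0 V \ D).card (2 * l + 1) := fun l => by
          rw [ih _ _ _ (by simp)]
          congr 1
          simp [add_comm]
        simp only [le_refl, if_true, h1, h2]
        obtain _ | k := k
        · cases s <;> simp [hb0]
        · rw [show (0 : ℤ).natAbs + 2 * (k + 1) = (2 * k + 1) + 1 by simp; omega, hb]
          rw [show 2 * k + 1 + 2 = 2 * (k + 1) + 1 by ring]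
          cases s <;> simp [add_comm]
      · obtain rfl : s = true := by
          cases s
          · simp at hx; omega
          · rfl
        simp only [not_le.2 h0, h0.le, if_true, if_false]
        rw [ih _ _ _ (by simp; omega),
          ih _ _ _ (by simp; omega),
          show x.natAbs + 2 * k = ((x - 1).natAbs + 2 * k) + 1 by omega, hb, add_comm]
        congr 2
        omega

/-! ### Crossings of the path as sign changes along the columns. -/

/-- Number of changes in the sequence of non-zero signs of `u c - t c` for `c < n`, followed by the
sign `s` (`true` being the positive sign). -/
def signChanges (t u : ℕ → ℕ) : ℕ → Bool → ℕ
  | 0, _ => 0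
  | n + 1, s =>
    if t n < u n then (if s then 0 else 1) + signChanges t u n true
    else if u n < t n then (if s then 1 else 0) + signChanges t u n false
    else signChanges t u n s

/-- The `min` counts the columns with both entries at most `V`. Removing the value `V + 1` removes a
column exactly when `V + 1` is the larger (or the common) entry of the last one, and the height then
shows the sign of that column. -/
theorem signChanges_nth_eq_crossings (p q : ℕ → Prop) [DecidablePred p] [DecidablePred q]
    (A D : Finset ℕ) (hAD : Disjoint A D) (hp0 : ¬ p 0) (V : ℕ)
    (hp : ∀ v, 0 < v → v ≤ V → (p v ↔ v ∈ A ∨ v ∈ D))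
    (hq : ∀ v, 0 < v → v ≤ V → (q v ↔ v ∉ A)) (s : Bool)
    (hs : if s then Nat.count q (V + 1) ≤ Nat.count p (V + 1)
      else Nat.count p (V + 1) ≤ Nat.count q (V + 1)) :
    signChanges (Nat.nth p) (Nat.nth q) (min (Nat.count p (V + 1)) (Nat.count q (V + 1))) s =
      crossings A D V ((Nat.count p (V + 1) : ℤ) - Nat.count q (V + 1)) s := by
  induction V generalizing s with
  | zero => simp [Nat.count_succ, hp0, signChanges, crossings]
  | succ V ih =>
    have ih' := ih (fun v h0 h1 => hp v h0 (by omega)) (fun v h0 h1 => hq v h0 (by omega))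
    have hpV := hp (V + 1) (by omega) le_rfl
    have hqV := hq (V + 1) (by omega) le_rfl
    have hplt : ∀ c, c < Nat.count p (V + 1) → Nat.nth p c < V + 1 := fun c hc =>
      Nat.nth_lt_of_lt_count hc
    have hqlt : ∀ c, c < Nat.count q (V + 1) → Nat.nth q c < V + 1 := fun c hc =>
      Nat.nth_lt_of_lt_count hc
    have hpe : p (V + 1) → Nat.nth p (Nat.count p (V + 1)) = V + 1 := fun h => Nat.nth_count h
    have hqe : q (V + 1) → Nat.nth q (Nat.count q (V + 1)) = V + 1 := fun h => Nat.nth_count h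
    rw [Nat.count_succ p (V + 1), Nat.count_succ q (V + 1)] at hs ⊢
    set α := Nat.count p (V + 1)
    set β := Nat.count q (V + 1)
    rw [crossings]
    by_cases hD : V + 1 ∈ D
    · have hA : V + 1 ∉ A := fun h => Finset.disjoint_left.1 hAD h hD
      have hpt : p (V + 1) := hpV.2 (Or.inr hD)
      have hqt : q (V + 1) := hqV.2 hA
      simp only [hpt, hqt, if_true] at hs ⊢
      have hs' : if s then β ≤ α else α ≤ β := by split_ifs at hs ⊢ <;> omega
      rw [if_pos hD, show ((α + 1 : ℕ) : ℤ) - ((β + 1 : ℕ) : ℤ) = (α : ℤ) - β by push_cast; ring,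
        ← ih' s hs', show min (α + 1) (β + 1) = min α β + 1 by omega, signChanges]
      -- If `α = β`, both entries of the removed column are `V + 1` and it has no sign. Otherwise
      -- `hs'` forces `s` to be the sign of that column, so no change is counted.
      rcases lt_trichotomy α β with h | h | h
      · rw [min_eq_left h.le, hpe hpt]
        have := hqlt α h
        cases s
        · simp [this, this.le]
        · simp at hs'; omega
      · rw [← h, min_self, hpe hpt, h, hqe hqt]
        simp
      · rw [min_eq_right h.le, hqe hqt]
        have := hplt β h
        cases s
        · simp at hs'; omega
        · simp [this]
    · rw [if_neg hD]
      by_cases hA : V + 1 ∈ A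
      · have hpt : p (V + 1) := hpV.2 (Or.inl hA)
        have hqt : ¬ q (V + 1) := fun h => hqV.1 h hA
        simp only [hpt, hqt, if_true, if_false, add_zero] at hs ⊢
        rw [if_pos hA, show ((α + 1 : ℕ) : ℤ) - (β : ℤ) - 1 = (α : ℤ) - β by push_cast; ring]
        split_ifs with h1 h2
        all_goals push_cast at h1
        · rw [← ih' _ (by simp; omega), min_eq_left (by omega : α + 1 ≤ β),
            min_eq_left (by omega : α ≤ β), signChanges, hpe hpt]
          have := hqlt α (by omega)
          simp [this, this.le, h2]
        · rw [← ih' _ (by simp; omega), min_eq_left (by omega : α + 1 ≤ β),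
            min_eq_left (by omega : α ≤ β), signChanges, hpe hpt]
          have := hqlt α (by omega)
          simp [this, this.le, h2]
        · rw [← ih' s (by split_ifs at hs ⊢ <;> omega), min_eq_right (by omega : β ≤ α + 1),
            min_eq_right (by omega : β ≤ α)]
      · have hpt : ¬ p (V + 1) := fun h => (hpV.1 h).elim hA hD
        have hqt : q (V + 1) := hqV.2 hA
        simp only [hpt, hqt, if_true, if_false, add_zero] at hs ⊢
        rw [if_neg hA, show (α : ℤ) - ((β + 1 : ℕ) : ℤ) + 1 = (α : ℤ) - β by push_cast; ring]
        split_ifs with h1 h2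
        all_goals push_cast at h1
        · rw [← ih' _ (by simp; omega), min_eq_right (by omega : β + 1 ≤ α),
            min_eq_right (by omega : β ≤ α), signChanges, hqe hqt]
          have := hplt β (by omega)
          simp [this, h2]
        · rw [← ih' _ (by simp; omega), min_eq_right (by omega : β + 1 ≤ α),
            min_eq_right (by omega : β ≤ α), signChanges, hqe hqt]
          have := hplt β (by omega)
          simp [this, h2]
        · rw [← ih' s (by split_ifs at hs ⊢ <;> omega), min_eq_left (by omega : α ≤ β + 1),
            min_eq_left (by omega : α ≤ β)]

/-! ### Inversion pairs as sign changes. -/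

/-- The first column after `c` where `t` and `u` differ lies before `n` and satisfies `r`, or else
there is no such column and `e` holds. -/
def NextUnequal (t u : ℕ → ℕ) (n : ℕ) (e : Prop) (r : ℕ → Prop) (c : ℕ) : Prop :=
  ∃ j, (∀ k, 1 ≤ k → k ≤ j → c + k < n ∧ t (c + k) = u (c + k)) ∧
    ((n ≤ c + j + 1 ∧ e) ∨ (c + j + 1 < n ∧ r (c + j + 1)))

/-- The last column can be absorbed into the default outcome `e`; this turns the search to the right
into a recursion on `n`. -/
theorem nextUnequal_succ {t u : ℕ → ℕ} {n c : ℕ} (hc : c < n) {e : Prop} {r : ℕ → Prop}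
    (hr : ∀ i, r i → t i ≠ u i) :
    NextUnequal t u (n + 1) e r c ↔ NextUnequal t u n (if t n = u n then e else r n) r c := by
  constructor
  · rintro ⟨j, hj, ⟨h, he⟩ | ⟨h, hrj⟩⟩
    -- The run of equal columns reaches column `n` itself; dropping that column shortens the run by
    -- one.
    · have hj0 : 1 ≤ j := by omega
      have h1 := hj j hj0 le_rfl
      have h2 : c + j = n := by omega
      rw [h2] at h1
      refine ⟨j - 1, fun k hk hkj => ⟨by omega, (hj k hk (by omega)).2⟩, Or.inl ⟨by omega, ?_⟩⟩
      rwa [if_pos h1.2]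
    · refine ⟨j, fun k hk hkj => ⟨by omega, (hj k hk hkj).2⟩, ?_⟩
      by_cases h2 : c + j + 1 = n
      · left
        rw [h2] at hrj
        refine ⟨by omega, ?_⟩
        rwa [if_neg (hr n hrj)]
      · exact Or.inr ⟨by omega, hrj⟩
  · rintro ⟨j, hj, ⟨h, he⟩ | ⟨h, hrj⟩⟩
    · have h2 : c + j + 1 = n := by
        rcases Nat.eq_zero_or_pos j with rfl | hj0
        · omega
        · have := (hj j hj0 le_rfl).1
          omega
      split_ifs at he with hn
      · refine ⟨j + 1, fun k hk hkj => ?_, Or.inl ⟨by omega, he⟩⟩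
        by_cases hkj' : k = j + 1
        · rw [hkj', show c + (j + 1) = n by omega]
          exact ⟨by omega, hn⟩
        · have := hj k hk (by omega)
          exact ⟨by omega, this.2⟩
      · refine ⟨j, fun k hk hkj => ?_, Or.inr ⟨by omega, by rwa [h2]⟩⟩
        have := hj k hk hkj
        exact ⟨by omega, this.2⟩
    · refine ⟨j, fun k hk hkj => ?_, Or.inr ⟨by omega, hrj⟩⟩
      have := hj k hk hkj
      exact ⟨by omega, this.2⟩

theorem nextUnequal_self {t u : ℕ → ℕ} {n : ℕ} {e : Prop} {r : ℕ → Prop} :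
    NextUnequal t u (n + 1) e r n ↔ e := by
  constructor
  · rintro ⟨j, hj, ⟨h, he⟩ | ⟨h, hrj⟩⟩
    · exact he
    · omega
  · intro he
    exact ⟨0, fun k hk hkj => by omega, Or.inl ⟨by omega, he⟩⟩

/-- A sign change happens after column `c`. -/
def SignChangeAt (t u : ℕ → ℕ) (n : ℕ) (s : Bool) (c : ℕ) : Prop :=
  (t c < u c ∧ NextUnequal t u n (s = false) (fun i => u i < t i) c) ∨
    (u c < t c ∧ NextUnequal t u n (s = true) (fun i => t i < u i) c)

theorem signChangeAt_succ {t u : ℕ → ℕ} {n c : ℕ} (hc : c < n) (s : Bool) :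
    SignChangeAt t u (n + 1) s c ↔
      SignChangeAt t u n (if t n < u n then true else if u n < t n then false else s) c := by
  rw [SignChangeAt, SignChangeAt, nextUnequal_succ hc (fun i hi => hi.ne'),
    nextUnequal_succ hc (fun i hi => hi.ne)]
  rcases lt_trichotomy (t n) (u n) with h | h | h
  · simp [h, h.ne, h.not_gt]
  · simp [h]
  · simp [h, h.ne', h.not_gt]

open Classical in
theorem card_signChangeAt (t u : ℕ → ℕ) (n : ℕ) (s : Bool) :
    ((Finset.range n).filter (SignChangeAt t u n s)).card = signChanges t u n s := by
  induction n generalizing s with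
  | zero => rfl
  | succ n ih =>
    have h1 : (Finset.range n).filter (SignChangeAt t u (n + 1) s) = (Finset.range n).filter
        (SignChangeAt t u n (if t n < u n then true else if u n < t n then false else s)) :=
      Finset.filter_congr fun c hc => signChangeAt_succ (Finset.mem_range.1 hc) s
    have h2 : SignChangeAt t u (n + 1) s n ↔ (t n < u n ∧ s = false) ∨ (u n < t n ∧ s = true) := by
      rw [SignChangeAt, nextUnequal_self, nextUnequal_self]
    rw [Finset.range_add_one, Finset.filter_insert, h1, signChanges]
    split_ifs with h3 h4 h5 h6 h5 h4 h5 h6 h5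
    all_goals first
      | rw [Finset.card_insert_of_notMem (by simp), ih]
      | rw [ih]
    all_goals rw [h2] at h3
    all_goals simp_all
    all_goals omega

theorem mem_of_rowLens_eq_pair {lam : YoungDiagram} {a b : ℕ} (h : lam.rowLens = [a, b])
    (i j : ℕ) : (i, j) ∈ lam ↔ (i = 0 ∧ j < a) ∨ (i = 1 ∧ j < b) := by
  have hlen : lam.colLen 0 = 2 := by
    rw [← YoungDiagram.length_rowLens, h]; rfl
  have h' := h
  rw [YoungDiagram.rowLens, hlen] at h'
  simp [List.range_succ] at h'
  obtain _ | _ | i := i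
  · simp [YoungDiagram.mem_iff_lt_rowLen, h'.1]
  · simp [YoungDiagram.mem_iff_lt_rowLen, h'.2]
  · have : (i + 2, j) ∉ lam := fun hm => by
      have := YoungDiagram.mem_iff_lt_colLen.1 (lam.up_left_mem le_rfl (Nat.zero_le j) hm)
      omega
    simp [this]

namespace YoungFilling

variable {lam : YoungDiagram}

theorem inv_eq_signChanges {a b : ℕ} (hab : b ≤ a) (h : lam.rowLens = [a, b])
    (T : YoungFilling lam) : T.inv = signChanges (T.entry 0) (T.entry 1) b true := by
  classical
  have hm := mem_of_rowLens_eq_pair h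
  have hm0 : ∀ c, (0, c) ∈ lam ↔ c < a := fun c => by simp [hm]
  have hm1 : ∀ c, (1, c) ∈ lam ↔ c < b := fun c => by simp [hm]
  -- As `b ≤ a`, the bottom row ends first. Running off its end gives an inversion only if the
  -- smaller entry is below, which is the effect of a final positive sign.
  have h01 : ∀ c, T.IsInversionPair c 0 1 ↔ c < b ∧ T.entry 0 c < T.entry 1 c ∧
      NextUnequal (T.entry 0) (T.entry 1) b (true = false)
        (fun i => T.entry 1 i < T.entry 0 i) c := by
    intro c
    simp only [IsInversionPair, NextUnequal, hm0, hm1]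
    constructor
    · rintro ⟨h1, h2, h3, n, h4, h5⟩
      refine ⟨by omega, h3, n, fun k hk hkn => ?_, by omega⟩
      have := h4 k hk hkn
      omega
    · rintro ⟨h1, h3, n, h4, h5⟩
      refine ⟨by omega, by omega, h3, n, fun k hk hkn => ?_, Or.inr ?_⟩
      · have := h4 k hk hkn
        omega
      · simp at h5
        omega
  have h10 : ∀ c, T.IsInversionPair c 1 0 ↔ c < b ∧ T.entry 1 c < T.entry 0 c ∧
      NextUnequal (T.entry 0) (T.entry 1) b (true = true)
        (fun i => T.entry 0 i < T.entry 1 i) c := by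
    intro c
    simp only [IsInversionPair, NextUnequal, hm0, hm1]
    constructor
    · rintro ⟨h1, h2, h3, n, h4, h5⟩
      refine ⟨by omega, h3, n, fun k hk hkn => ?_, by simp only [and_true]; omega⟩
      have := h4 k hk hkn
      omega
    · rintro ⟨h1, h3, n, h4, h5⟩
      refine ⟨by omega, by omega, h3, n, fun k hk hkn => ?_, by omega⟩
      have := h4 k hk hkn
      omega
  have hrows : ∀ c p q, T.IsInversionPair c p q → (p = 0 ∧ q = 1) ∨ (p = 1 ∧ q = 0) := by
    intro c p q hc
    have h1 := (hm _ _).1 hc.1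
    have h2 := (hm _ _).1 hc.2.1
    have h3 := hc.2.2.1
    have : p ≠ q := by rintro rfl; omega
    omega
  rw [← card_signChangeAt, inv]
  refine Finset.card_bij (fun x _ => x.1.2) ?_ ?_ ?_
  · rintro ⟨⟨p, c⟩, ⟨q, c'⟩⟩ hx
    obtain ⟨-, rfl : c = c', hx⟩ := Finset.mem_filter.1 hx
    rw [Finset.mem_filter, Finset.mem_range]
    obtain ⟨rfl, rfl⟩ | ⟨rfl, rfl⟩ := hrows c p q hx
    · exact ⟨((h01 c).1 hx).1, Or.inl ((h01 c).1 hx).2⟩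
    · exact ⟨((h10 c).1 hx).1, Or.inr ((h10 c).1 hx).2⟩
  · rintro ⟨⟨p, c⟩, ⟨q, c'⟩⟩ hx ⟨⟨p₁, d⟩, ⟨q₁, d'⟩⟩ hy hxy
    obtain ⟨-, rfl : c = c', hx⟩ := Finset.mem_filter.1 hx
    obtain ⟨-, rfl : d = d', hy⟩ := Finset.mem_filter.1 hy
    obtain rfl : c = d := hxy
    have h3 : T.entry p c < T.entry q c := hx.2.2.1
    have h4 : T.entry p₁ c < T.entry q₁ c := hy.2.2.1
    obtain ⟨rfl, rfl⟩ | ⟨rfl, rfl⟩ := hrows c p q hx <;>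
      obtain ⟨rfl, rfl⟩ | ⟨rfl, rfl⟩ := hrows c p₁ q₁ hy <;> first | rfl | omega
  · intro c hc
    obtain ⟨hc, h1 | h1⟩ := Finset.mem_filter.1 hc
    · have h2 := (h01 c).2 ⟨Finset.mem_range.1 hc, h1⟩
      exact ⟨((0, c), (1, c)), Finset.mem_filter.2 ⟨Finset.mem_product.2
        ⟨(YoungDiagram.mem_cells _).2 h2.1, (YoungDiagram.mem_cells _).2 h2.2.1⟩, rfl, h2⟩, rfl⟩
    · have h2 := (h10 c).2 ⟨Finset.mem_range.1 hc, h1⟩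
      exact ⟨((1, c), (0, c)), Finset.mem_filter.2 ⟨Finset.mem_product.2
        ⟨(YoungDiagram.mem_cells _).2 h2.1, (YoungDiagram.mem_cells _).2 h2.2.1⟩, rfl, h2⟩, rfl⟩

end YoungFilling

/-! ### Fillings as pairs of sets of values. -/

theorem injOn_of_lt {t : ℕ → ℕ} {n : ℕ} (h : ∀ i j, i < j → j < n → t i < t j) :
    Set.InjOn t (Finset.range n) := by
  intro i hi j hj hij
  have hi' := Finset.mem_range.1 hi
  have hj' := Finset.mem_range.1 hj
  rcases lt_trichotomy i j with hlt | rfl | hlt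
  · have := h _ _ hlt hj'; omega
  · rfl
  · have := h _ _ hlt hi'; omega

/-- An increasing row is the increasing enumeration of its set of values, so it can be recovered
from that set. -/
theorem nth_mem_image_range {t : ℕ → ℕ} {n : ℕ} (h : ∀ i j, i < j → j < n → t i < t j) {c : ℕ}
    (hc : c < n) : Nat.nth (· ∈ (Finset.range n).image t) c = t c := by
  have hcount : Nat.count (· ∈ (Finset.range n).image t) (t c) = c := by
    rw [Nat.count_eq_card_filter_range]
    have : (Finset.range (t c)).filter (· ∈ (Finset.range n).image t) =
        (Finset.range c).image t := by
      ext v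
      simp only [Finset.mem_filter, Finset.mem_range, Finset.mem_image]
      constructor
      · rintro ⟨h1, i, hi, rfl⟩
        refine ⟨i, ?_, rfl⟩
        rcases lt_trichotomy i c with hlt | rfl | hlt
        · exact hlt
        · omega
        · have := h _ _ hlt hi; omega
      · rintro ⟨i, hi, rfl⟩
        exact ⟨h _ _ hi hc, i, by omega, rfl⟩
    rw [this, Finset.card_image_of_injOn, Finset.card_range]
    exact (injOn_of_lt h).mono fun x hx => by simp at hx ⊢; omega
  have hmem : t c ∈ (Finset.range n).image t := Finset.mem_image_of_mem _ (Finset.mem_range.2 hc)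
  have := Nat.nth_count (p := (· ∈ (Finset.range n).image t)) hmem
  rwa [hcount] at this

theorem signChanges_congr {t u t' u' : ℕ → ℕ} {n : ℕ} (ht : ∀ c < n, t c = t' c)
    (hu : ∀ c < n, u c = u' c) (s : Bool) : signChanges t u n s = signChanges t' u' n s := by
  induction n generalizing s with
  | zero => rfl
  | succ n ih =>
    have ih' := ih (fun c hc => ht c (by omega)) (fun c hc => hu c (by omega))
    simp only [signChanges, ih', ht n (by omega), hu n (by omega)]

theorem count_mem_eq_card {X : Finset ℕ} {n : ℕ} (h : ∀ v ∈ X, v < n) :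
    Nat.count (· ∈ X) n = X.card := by
  rw [Nat.count_eq_card_filter_range]
  congr 1
  ext v
  simp only [Finset.mem_filter, Finset.mem_range]
  exact ⟨fun hv => hv.2, fun hv => ⟨h v hv, hv⟩⟩

namespace YoungFilling

variable {lam : YoungDiagram} {a b : ℕ}

/-- The set of the first `n` entries of row `i`. -/
def rowSet (T : YoungFilling lam) (i n : ℕ) : Finset ℕ := (Finset.range n).image (T.entry i)

theorem RowStandard.lt_row_zero {T : YoungFilling lam} (hT : T.RowStandard)
    (h : lam.rowLens = [a, b]) (i j : ℕ) (hij : i < j) (hj : j < a) :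
    T.entry 0 i < T.entry 0 j :=
  hT 0 i j hij ((mem_of_rowLens_eq_pair h _ _).2 (Or.inl ⟨rfl, hj⟩))

theorem RowStandard.lt_row_one {T : YoungFilling lam} (hT : T.RowStandard)
    (h : lam.rowLens = [a, b]) (i j : ℕ) (hij : i < j) (hj : j < b) :
    T.entry 1 i < T.entry 1 j :=
  hT 1 i j hij ((mem_of_rowLens_eq_pair h _ _).2 (Or.inr ⟨rfl, hj⟩))

theorem card_filter_eq_of_injOn {t : ℕ → ℕ} {n : ℕ} (h : Set.InjOn t (Finset.range n)) (w : ℕ) :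
    ((Finset.range n).filter fun c => t c = w).card =
      if w ∈ (Finset.range n).image t then 1 else 0 := by
  split_ifs with hw
  · obtain ⟨c, hc, rfl⟩ := Finset.mem_image.1 hw
    rw [Finset.card_eq_one]
    refine ⟨c, ?_⟩
    ext d
    simp only [Finset.mem_filter, Finset.mem_singleton]
    constructor
    · exact fun hd => h hd.1 hc hd.2
    · rintro rfl
      exact ⟨hc, rfl⟩
  · rw [Finset.card_eq_zero, Finset.filter_eq_empty_iff]
    intro c hc hcw
    exact hw (Finset.mem_image.2 ⟨c, hc, hcw⟩)

theorem card_cells_filter_entry {T : YoungFilling lam} (hT : T.RowStandard)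
    (h : lam.rowLens = [a, b]) (w : ℕ) :
    (lam.cells.filter fun c => T.entry c.1 c.2 = w).card =
      (if w ∈ T.rowSet 0 a then 1 else 0) + if w ∈ T.rowSet 1 b then 1 else 0 := by
  have hcells : lam.cells = (Finset.range a).image (Prod.mk 0) ∪
      (Finset.range b).image (Prod.mk 1) := by
    ext ⟨i, j⟩
    rw [YoungDiagram.mem_cells, mem_of_rowLens_eq_pair h]
    simp [eq_comm, and_comm]
  have hdisj : Disjoint ((Finset.range a).image (Prod.mk 0))
      ((Finset.range b).image (Prod.mk 1)) := by
    rw [Finset.disjoint_left]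
    intro x hx hy
    simp only [Finset.mem_image] at hx hy
    obtain ⟨i, -, rfl⟩ := hx
    obtain ⟨j, -, hj⟩ := hy
    simp at hj
  rw [Finset.card_filter, hcells, Finset.sum_union hdisj, Finset.sum_image (by simp),
    Finset.sum_image (by simp), ← Finset.card_filter, ← Finset.card_filter,
    card_filter_eq_of_injOn (injOn_of_lt (hT.lt_row_zero h)),
    card_filter_eq_of_injOn (injOn_of_lt (hT.lt_row_one h))]
  rfl

theorem card_rowSet_zero {T : YoungFilling lam} (hT : T.RowStandard)
    (h : lam.rowLens = [a, b]) : (T.rowSet 0 a).card = a := by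
  rw [rowSet, Finset.card_image_of_injOn (injOn_of_lt (hT.lt_row_zero h)), Finset.card_range]

theorem card_rowSet_one {T : YoungFilling lam} (hT : T.RowStandard)
    (h : lam.rowLens = [a, b]) : (T.rowSet 1 b).card = b := by
  rw [rowSet, Finset.card_image_of_injOn (injOn_of_lt (hT.lt_row_one h)), Finset.card_range]

/-- The values used twice in a filling of content `μ`. -/
def doubleValues {M : ℕ} (μ : Fin M → ℕ) : Finset ℕ :=
  (Finset.univ.filter fun i => μ i = 2).image fun i : Fin M => (i : ℕ) + 1

theorem mem_doubleValues {M : ℕ} (μ : Fin M → ℕ) (i : Fin M) :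
    (i : ℕ) + 1 ∈ doubleValues μ ↔ μ i = 2 := by
  simp only [doubleValues, Finset.mem_image, Finset.mem_filter, Finset.mem_univ, true_and]
  constructor
  · rintro ⟨j, hj, hji⟩
    rwa [← Fin.ext (Nat.succ_injective hji)]
  · intro hi
    exact ⟨i, hi, rfl⟩

theorem card_doubleValues {M : ℕ} (μ : Fin M → ℕ) :
    (doubleValues μ).card = (Finset.univ.filter fun i => μ i = 2).card :=
  Finset.card_image_of_injective _ fun _ _ hij => Fin.ext (Nat.succ_injective hij)

theorem doubleValues_subset {M : ℕ} (μ : Fin M → ℕ) : doubleValues μ ⊆ Finset.Ioc 0 M := by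
  intro v hv
  obtain ⟨i, -, rfl⟩ := Finset.mem_image.1 hv
  have := i.isLt
  simp only [Finset.mem_Ioc]
  omega

/-- Each value occurs at most once per row, so its multiplicity is the number of rows containing it:
multiplicity two means both rows, multiplicity one exactly one of them. -/
theorem hasContent_iff {T : YoungFilling lam} (hT : T.RowStandard) (h : lam.rowLens = [a, b])
    {M : ℕ} {μ : Fin M → ℕ} (hμ : ∀ i, μ i = 1 ∨ μ i = 2) :
    T.HasContent μ ↔ ∃ A ⊆ Finset.Ioc 0 M \ doubleValues μ,
      T.rowSet 0 a = A ∪ doubleValues μ ∧ T.rowSet 1 b = Finset.Ioc 0 M \ A := by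
  have hm := mem_of_rowLens_eq_pair h
  have h0 : ∀ v ∈ T.rowSet 0 a, 0 < v := by
    intro v hv
    obtain ⟨c, hc, rfl⟩ := Finset.mem_image.1 hv
    exact T.pos ((hm 0 c).2 (Or.inl ⟨rfl, Finset.mem_range.1 hc⟩))
  have h1 : ∀ v ∈ T.rowSet 1 b, 0 < v := by
    intro v hv
    obtain ⟨c, hc, rfl⟩ := Finset.mem_image.1 hv
    exact T.pos ((hm 1 c).2 (Or.inr ⟨rfl, Finset.mem_range.1 hc⟩))
  constructor
  · rintro ⟨hle, hcount⟩
    have h0' : ∀ v ∈ T.rowSet 0 a, v ≤ M := by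
      intro v hv
      obtain ⟨c, hc, rfl⟩ := Finset.mem_image.1 hv
      exact hle (0, c) ((YoungDiagram.mem_cells _).2
        ((hm 0 c).2 (Or.inl ⟨rfl, Finset.mem_range.1 hc⟩)))
    have h1' : ∀ v ∈ T.rowSet 1 b, v ≤ M := by
      intro v hv
      obtain ⟨c, hc, rfl⟩ := Finset.mem_image.1 hv
      exact hle (1, c) ((YoungDiagram.mem_cells _).2
        ((hm 1 c).2 (Or.inr ⟨rfl, Finset.mem_range.1 hc⟩)))
    have key : ∀ v, 0 < v → v ≤ M → (v ∈ T.rowSet 0 a ∨ v ∈ T.rowSet 1 b) ∧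
        (v ∈ doubleValues μ ↔ v ∈ T.rowSet 0 a ∧ v ∈ T.rowSet 1 b) := by
      intro v hv hvM
      obtain ⟨v, rfl⟩ := Nat.exists_eq_succ_of_ne_zero hv.ne'
      have hc := hcount ⟨v, by omega⟩
      have hd := mem_doubleValues μ ⟨v, by omega⟩
      rw [card_cells_filter_entry hT h] at hc
      simp only at hc hd
      rw [Nat.succ_eq_add_one, hd, ← hc]
      have := hμ ⟨v, by omega⟩
      rw [← hc] at this
      clear hcount hc hd
      split_ifs at this ⊢ <;> simp_all
    refine ⟨T.rowSet 0 a \ doubleValues μ, ?_, ?_, ?_⟩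
    · intro v hv
      rw [Finset.mem_sdiff] at hv ⊢
      exact ⟨Finset.mem_Ioc.2 ⟨h0 v hv.1, h0' v hv.1⟩, hv.2⟩
    · rw [Finset.sdiff_union_of_subset]
      intro v hv
      have hv' := Finset.mem_Ioc.1 (doubleValues_subset μ hv)
      exact ((key v hv'.1 hv'.2).2.1 hv).1
    · ext v
      simp only [Finset.mem_sdiff, Finset.mem_Ioc]
      constructor
      · intro hv
        have := key v (h1 v hv) (h1' v hv)
        exact ⟨⟨h1 v hv, h1' v hv⟩, fun h2 => h2.2 (this.2.2 ⟨h2.1, hv⟩)⟩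
      · rintro ⟨hv, h2⟩
        have := key v hv.1 hv.2
        tauto
  · rintro ⟨A, hA, hX, hY⟩
    have hXM : T.rowSet 0 a ⊆ Finset.Ioc 0 M := by
      rw [hX]
      exact Finset.union_subset (hA.trans Finset.sdiff_subset) (doubleValues_subset μ)
    have hYM : T.rowSet 1 b ⊆ Finset.Ioc 0 M := by
      rw [hY]
      exact Finset.sdiff_subset
    refine ⟨?_, ?_⟩
    · rintro ⟨i, c⟩ hic
      obtain ⟨rfl, hc : c < _⟩ | ⟨rfl, hc : c < _⟩ := (hm i c).1 ((YoungDiagram.mem_cells _).1 hic)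
      · exact (Finset.mem_Ioc.1 (hXM (Finset.mem_image_of_mem _ (Finset.mem_range.2 hc)))).2
      · exact (Finset.mem_Ioc.1 (hYM (Finset.mem_image_of_mem _ (Finset.mem_range.2 hc)))).2
    · intro i
      rw [card_cells_filter_entry hT h, hX, hY]
      have hd := mem_doubleValues μ i
      have hi : (i : ℕ) + 1 ∈ Finset.Ioc 0 M := by
        have := i.isLt
        simp only [Finset.mem_Ioc]
        omega
      simp only [Finset.mem_union, Finset.mem_sdiff, hd, hi, true_and]
      have hA' : (i : ℕ) + 1 ∈ A → μ i ≠ 2 := fun h1 h2 =>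
        (Finset.mem_sdiff.1 (hA h1)).2 (hd.2 h2)
      have := hμ i
      split_ifs <;> first | omega | tauto

theorem inv_eq_crossings {T : YoungFilling lam} (hT : T.RowStandard) (hab : b ≤ a)
    (h : lam.rowLens = [a, b]) {A D : Finset ℕ} {M : ℕ} (hD : D ⊆ Finset.Ioc 0 M)
    (hA : A ⊆ Finset.Ioc 0 M \ D) (hX : T.rowSet 0 a = A ∪ D)
    (hY : T.rowSet 1 b = Finset.Ioc 0 M \ A) :
    T.inv = crossings A D M ((a : ℤ) - b) true := by
  have hXM : T.rowSet 0 a ⊆ Finset.Ioc 0 M := by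
    rw [hX]
    exact Finset.union_subset (hA.trans Finset.sdiff_subset) hD
  have hYM : T.rowSet 1 b ⊆ Finset.Ioc 0 M := by
    rw [hY]
    exact Finset.sdiff_subset
  have ha : Nat.count (· ∈ T.rowSet 0 a) (M + 1) = a := by
    rw [count_mem_eq_card, card_rowSet_zero hT h]
    intro v hv
    have := Finset.mem_Ioc.1 (hXM hv)
    omega
  have hb : Nat.count (· ∈ T.rowSet 1 b) (M + 1) = b := by
    rw [count_mem_eq_card, card_rowSet_one hT h]
    intro v hv
    have := Finset.mem_Ioc.1 (hYM hv)
    omega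
  have key := signChanges_nth_eq_crossings (· ∈ T.rowSet 0 a) (· ∈ T.rowSet 1 b) A D
    (Finset.disjoint_left.2 fun v hv => (Finset.mem_sdiff.1 (hA hv)).2)
    (fun h0 => by simpa using hXM h0) M
    (fun v _ _ => by rw [hX, Finset.mem_union])
    (fun v h0 h1 => by simp [hY, h0, h1]) true (by simpa [ha, hb] using hab)
  rw [ha, hb, min_eq_right hab] at key
  rw [← key, inv_eq_signChanges hab h]
  apply signChanges_congr
  · intro c hc
    exact (nth_mem_image_range (hT.lt_row_zero h) (hc.trans_le hab)).symm
  · intro c hc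
    exact (nth_mem_image_range (hT.lt_row_one h) hc).symm

theorem ext_of_rowSet {T T' : YoungFilling lam} (hT : T.RowStandard) (hT' : T'.RowStandard)
    (h : lam.rowLens = [a, b]) (h0 : T.rowSet 0 a = T'.rowSet 0 a)
    (h1 : T.rowSet 1 b = T'.rowSet 1 b) : T = T' := by
  have he : T.entry = T'.entry := by
    funext i j
    by_cases hij : (i, j) ∈ lam
    · obtain ⟨rfl, hj⟩ | ⟨rfl, hj⟩ := (mem_of_rowLens_eq_pair h i j).1 hij
      · rw [← nth_mem_image_range (hT.lt_row_zero h) hj,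
          ← nth_mem_image_range (hT'.lt_row_zero h) hj]
        exact congrArg (fun X : Finset ℕ => Nat.nth (· ∈ X) j) h0
      · rw [← nth_mem_image_range (hT.lt_row_one h) hj,
          ← nth_mem_image_range (hT'.lt_row_one h) hj]
        exact congrArg (fun X : Finset ℕ => Nat.nth (· ∈ X) j) h1
    · rw [T.zeros hij, T'.zeros hij]
  cases T
  cases T'
  cases he
  rfl

theorem nth_mem_of_lt_card {X : Finset ℕ} {c : ℕ} (hc : c < X.card) :
    Nat.nth (· ∈ X) c ∈ X :=
  Nat.nth_mem (p := (· ∈ X)) c fun hf => by simpa using hc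

theorem image_nth_range_card (X : Finset ℕ) :
    (Finset.range X.card).image (Nat.nth (· ∈ X)) = X := by
  ext v
  simp only [Finset.mem_image, Finset.mem_range]
  constructor
  · rintro ⟨c, hc, rfl⟩
    exact nth_mem_of_lt_card hc
  · intro hv
    obtain ⟨c, hc, hcv⟩ := Nat.exists_lt_card_nth_eq (p := (· ∈ X)) hv
    exact ⟨c, by simpa using hc X.finite_toSet, hcv⟩

theorem exists_rowSet_eq (h : lam.rowLens = [a, b]) {X Y : Finset ℕ} (hX : X.card = a)
    (hY : Y.card = b) {M : ℕ} (hXY : X ∪ Y = Finset.Ioc 0 M) :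
    ∃ T : YoungFilling lam, T.RowStandard ∧ T.rowSet 0 a = X ∧ T.rowSet 1 b = Y := by
  have hm := mem_of_rowLens_eq_pair h
  subst hX hY
  have hXM : X ⊆ Finset.Ioc 0 M := hXY ▸ Finset.subset_union_left
  have hYM : Y ⊆ Finset.Ioc 0 M := hXY ▸ Finset.subset_union_right
  let e : ℕ → ℕ → ℕ := fun i j =>
    if i = 0 then Nat.nth (· ∈ X) j else if i = 1 then Nat.nth (· ∈ Y) j else 0
  have he : ∀ {i j : ℕ}, (i, j) ∈ lam → e i j ∈ Finset.Ioc 0 M := by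
    intro i j hij
    obtain ⟨rfl, hj⟩ | ⟨rfl, hj⟩ := (hm i j).1 hij
    · exact hXM (nth_mem_of_lt_card hj)
    · exact hYM (nth_mem_of_lt_card hj)
  refine ⟨⟨e, fun hij => (Finset.mem_Ioc.1 (he hij)).1, ?_, ?_⟩, ?_, ?_, ?_⟩
  · intro i j hij
    rw [hm] at hij
    simp only [e]
    split_ifs with h0 h1
    -- Beyond the cardinality of a finite set `Nat.nth` takes the value `0`, as required outside the
    -- diagram.
    · exact Nat.nth_of_card_le X.finite_toSet (by simp; omega)
    · exact Nat.nth_of_card_le Y.finite_toSet (by simp; omega)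
    · rfl
  · intro i j hij v hv hve
    have hv' : v ∈ X ∪ Y := by
      rw [hXY]
      have := Finset.mem_Ioc.1 (he hij)
      exact Finset.mem_Ioc.2 ⟨hv, by omega⟩
    obtain hv' | hv' := Finset.mem_union.1 hv'
    · rw [← image_nth_range_card X] at hv'
      obtain ⟨c, hc, rfl⟩ := Finset.mem_image.1 hv'
      exact ⟨0, c, (hm 0 c).2 (Or.inl ⟨rfl, Finset.mem_range.1 hc⟩), rfl⟩
    · rw [← image_nth_range_card Y] at hv'
      obtain ⟨c, hc, rfl⟩ := Finset.mem_image.1 hv'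
      exact ⟨1, c, (hm 1 c).2 (Or.inr ⟨rfl, Finset.mem_range.1 hc⟩), rfl⟩
  · intro i j₁ j₂ hj hij
    obtain ⟨rfl, hj2⟩ | ⟨rfl, hj2⟩ := (hm i j₂).1 hij
    · exact Nat.nth_lt_nth' (p := (· ∈ X)) hj fun hf => by simpa using hj2
    · exact Nat.nth_lt_nth' (p := (· ∈ Y)) hj fun hf => by simpa using hj2
  · exact image_nth_range_card X
  · exact image_nth_range_card Y

end YoungFilling

open YoungFilling

/-! ### The bijection with paths and the final count. -/

theorem bijOn_invertedSSYT {a b : ℕ} (hab : b ≤ a) {lam : YoungDiagram}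
    (hlam : lam.rowLens = [a, b]) {M : ℕ} {μ : Fin M → ℕ} (hsum : ∑ i, μ i = a + b)
    (hμ : ∀ i, μ i = 1 ∨ μ i = 2) (k : ℕ) :
    Set.BijOn (fun T : YoungFilling lam => T.rowSet 0 a \ doubleValues μ) (invertedSSYT k lam μ)
      (((Finset.Ioc 0 M) \ doubleValues μ).powerset.filter fun A =>
        2 * (A.card : ℤ) = (((Finset.Ioc 0 M) \ doubleValues μ).card : ℤ) + ((a : ℤ) - b) ∧
          crossings A (doubleValues μ) M ((a : ℤ) - b) true = k) := by
  set D := doubleValues μ with hDdef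
  have hD : D ⊆ Finset.Ioc 0 M := doubleValues_subset μ
  have hM : M + D.card = a + b := by
    rw [← hsum, hDdef, card_doubleValues, Finset.card_filter]
    have : ∀ i, μ i = 1 + if μ i = 2 then 1 else 0 := by
      intro i
      have := hμ i
      split_ifs <;> omega
    rw [Finset.sum_congr rfl fun i _ => this i, Finset.sum_add_distrib]
    simp
  have hN : (Finset.Ioc 0 M \ D).card + D.card = M := by
    rw [Finset.card_sdiff_add_card_eq_card hD, Nat.card_Ioc]; rfl
  have hcard : ∀ A ⊆ Finset.Ioc 0 M \ D, (A ∪ D).card = A.card + D.card ∧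
      (Finset.Ioc 0 M \ A).card + A.card = M := by
    intro A hA
    refine ⟨Finset.card_union_of_disjoint
      (Finset.disjoint_left.2 fun v hv => (Finset.mem_sdiff.1 (hA hv)).2), ?_⟩
    rw [Finset.card_sdiff_add_card_eq_card (hA.trans Finset.sdiff_subset), Nat.card_Ioc]; rfl
  have hdiff : ∀ A ⊆ Finset.Ioc 0 M \ D, (A ∪ D) \ D = A := fun A hA =>
    Finset.union_sdiff_cancel_right
      (Finset.disjoint_left.2 fun v hv => (Finset.mem_sdiff.1 (hA hv)).2)
  refine ⟨?_, ?_, ?_⟩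
  · rintro T ⟨hT, hc, hk⟩
    obtain ⟨A, hA, hX, hY⟩ := (hasContent_iff hT hlam hμ).1 hc
    have h1 := card_rowSet_zero hT hlam
    have h2 := card_rowSet_one hT hlam
    have h3 := inv_eq_crossings hT hab hlam hD hA hX hY
    have h4 := hcard A hA
    rw [hX] at h1
    rw [hY] at h2
    simp only [Finset.coe_filter, Set.mem_ofPred_eq, Finset.mem_powerset]
    rw [hX, ← hDdef, hdiff A hA]
    refine ⟨hA, ?_, by rw [← h3, hk]⟩
    omega
  · rintro T ⟨hT, hc, hk⟩ T' ⟨hT', hc', hk'⟩ hTT'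
    obtain ⟨A, hA, hX, hY⟩ := (hasContent_iff hT hlam hμ).1 hc
    obtain ⟨A', hA', hX', hY'⟩ := (hasContent_iff hT' hlam hμ).1 hc'
    simp only at hTT'
    rw [hX, hX', ← hDdef, hdiff A hA, hdiff A' hA'] at hTT'
    subst hTT'
    exact ext_of_rowSet hT hT' hlam (hX.trans hX'.symm) (hY.trans hY'.symm)
  · intro A hA
    simp only [Finset.coe_filter, Set.mem_ofPred_eq, Finset.mem_powerset] at hA
    obtain ⟨hA, hx, hk⟩ := hA
    have h4 := hcard A hA
    obtain ⟨T, hT, hX, hY⟩ := exists_rowSet_eq hlam (X := A ∪ D) (Y := Finset.Ioc 0 M \ A) (M := M)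
      (by omega) (by omega) (by
        rw [Finset.union_right_comm, Finset.union_sdiff_of_subset (hA.trans Finset.sdiff_subset),
          Finset.union_eq_left.2 hD])
    refine ⟨T, ⟨hT, (hasContent_iff hT hlam hμ).2 ⟨A, hA, hX, hY⟩, ?_⟩, ?_⟩
    · rw [inv_eq_crossings hT hab hlam hD hA hX hY, hk]
    · simp only [hX, hdiff A hA]

theorem mainTheorem8 (a b : ℕ) (hb : 1 ≤ b) (hab : b ≤ a)
    (lam : YoungDiagram) (hlam : lam.rowLens = [a, b])
    (M : ℕ) (μ : Fin M → ℕ) (hsum : ∑ i, μ i = a + b)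
    (hμ : ∀ i, μ i = 1 ∨ μ i = 2)
    (m : ℕ) (hm : (Finset.univ.filter fun i => μ i = 2).card = m) (k : ℕ) :
    (invertedSSYT k lam μ).Finite ∧
      ((invertedSSYT k lam μ).ncard : ℚ) =
        ((a : ℚ) - b + 1 + 2 * k) / ((a : ℚ) + 1 + k - m) *
          (if k + m ≤ b then ((a + b - 2 * m).choose (b - k - m) : ℚ) else 0) := by
  have hbij := bijOn_invertedSSYT hab hlam hsum hμ k
  have hfin : (invertedSSYT k lam μ).Finite :=
    Set.Finite.of_finite_image (hbij.image_eq ▸ Finset.finite_toSet _) hbij.injOn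
  refine ⟨hfin, ?_⟩
  have hM : M + m = a + b := by
    rw [← hsum, ← hm, Finset.card_filter]
    have : ∀ i, μ i = 1 + if μ i = 2 then 1 else 0 := by
      intro i
      have := hμ i
      split_ifs <;> omega
    rw [Finset.sum_congr rfl fun i _ => this i, Finset.sum_add_distrib]
    simp
  have hN : (Finset.Ioc 0 M \ doubleValues μ).card = a + b - 2 * m := by
    rw [Finset.card_sdiff_of_subset (doubleValues_subset μ), card_doubleValues, hm, Nat.card_Ioc]
    omega
  have hcard : (invertedSSYT k lam μ).ncard = ballot (a + b - 2 * m) (a - b + 2 * k) := by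
    rw [← hbij.injOn.ncard_image, hbij.image_eq, Set.ncard_coe_finset]
    have := crossingCount_eq_ballot (doubleValues μ) M ((a : ℤ) - b) true k (by simpa using hab)
    rw [hN, show ((a : ℤ) - b).natAbs = a - b by omega] at this
    exact this
  -- With `hM` this gives `2 * m ≤ a + b`, so the subtraction in the number of steps is not
  -- truncated.
  have hmM : m ≤ M := by
    rw [← hm]
    exact (Finset.card_filter_le _ _).trans (by simp)
  rw [hcard]
  split_ifs with hk
  -- With `b = k + m + j` and `a = b + d`, the path has starting height `d + 2k` and `j` steps away
  -- from zero, the form required by `ballot_mul`.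
  · obtain ⟨j, rfl⟩ := Nat.exists_eq_add_of_le hk
    obtain ⟨d, rfl⟩ := Nat.exists_eq_add_of_le hab
    rw [show k + m + j + d + (k + m + j) - 2 * m = d + 2 * k + 2 * j by omega,
      show k + m + j + d - (k + m + j) + 2 * k = d + 2 * k by omega,
      show k + m + j - k - m = j by omega]
    have := ballot_mul (d + 2 * k) j
    have h' : (ballot (d + 2 * k + 2 * j) (d + 2 * k) : ℚ) * (d + 2 * k + j + 1) =
        (d + 2 * k + 1) * ((d + 2 * k + 2 * j).choose j : ℚ) := by exact_mod_cast this
    have hpos : (0 : ℚ) < d + 2 * k + j + 1 := by positivity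
    push_cast
    rw [show ((k : ℚ) + m + j + d + 1 + k - m) = d + 2 * k + j + 1 by ring, div_mul_eq_mul_div,
      eq_div_iff hpos.ne', h']
    ring
  -- For `b < k + m` the starting height exceeds the number of steps.
  · rw [ballot_eq_zero_of_lt (by omega)]
    simp
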